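/- Let $A:\mathbb{R}^d\to\mathbb{R}^m$ be linear, $A^*$ its adjoint, and $\|\cdot\|$, $\langle\cdot,\cdot\rangle$ the Euclidean norm and inner product (and the induced operator norm). Let $\sigma_1=\|A\|$ be the largest singular value of $A$. A singular value of $A$ is a number $\sigma\ge 0$ such that $\sigma^2$ is an eigenvalue of $A^*A$; its singular space is $\{v : A^*Av=\sigma^2 v\}$, the nonzero elements of that space are the right singular vectors for $\sigma$, and its dimension is the multiplicity of $\sigma$. Consider the following algorithm. Let $v^0$ be a (deterministic or random) vector in $\mathbb{R}^d$ with $\|v^0\|=1$ almost surely, and let $y^0,y^1,y^2,\dots\sim\mathcal N(0,I_d)$ be independent samples, jointly independent of $v^0$. For $k=0,1,2,\dots$ put $$x^k=\frac{y^k-\langle y^k,v^k\rangle v^k}{\|y^k-\langle y^k,v^k\rangle v^k\|},\qquad a_k=\langle Av^k,Ax^k\rangle,\qquad b_k=\|Ax^k\|^2-\|Av^k\|^2,$$ $$\tau_k=\operatorname{sign}(a_k)\left(\frac{b_k}{2|a_k|}+\sqrt{\frac{b_k^2}{4a_k^2}+1}\right),\qquad v^{k+1}=\frac{v^k+\tau_kx^k}{\sqrt{1+\tau_k^2}},$$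 where $x^k=0$ if $y^k-\langle y^k,v^k\rangle v^k=0$, and $\tau_k=0$ (so that the iteration stays at $v^k$) if $a_k=0$. Theorem. Suppose that, almost surely, $v^0$ is not a right singular vector of $A$ for a singular value $\sigma<\sigma_1$. Then: 1. $\lim_{k\to\infty}\|Av^k\|=\sigma_1=\|A\|$ almost surely. 2. If the singular space for $\sigma_1$ is one-dimensional, then almost surely $v^k$ converges to a right singular vector of $A$ for $\sigma_1$ (which may depend on the realization). 3. The stepsize formula does not break down prematurely: almost surely, for every $k$, $a_k=0$ occurs only if $v^k$ is a right singular vector for $\sigma_1$. If, moreover, no singular value of $A$ has multiplicity $d-1$ or $d$ and $v^0$ is almost surely not a right singular vector of $A$ at all, then almost surely $a_k\neq0$ for all $k$. -/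

import Mathlib

open MeasureTheory ProbabilityTheory Filter Topology
open scoped RealInnerProductSpace

noncomputable section

namespace RandomSearchNorm

variable {d m : ℕ}

/-- The linear map `A* A` on `ℝ^d`. -/
def gram (A : EuclideanSpace ℝ (Fin d) →L[ℝ] EuclideanSpace ℝ (Fin m)) :
    Module.End ℝ (EuclideanSpace ℝ (Fin d)) :=
  (ContinuousLinearMap.adjoint A ∘L A).toLinearMap

/-- The largest singular value `σ₁` of `A` (singular values are listed from index `0` on, in
non-increasing order, with multiplicity). -/
def sigmaOne (A : EuclideanSpace ℝ (Fin d) →L[ℝ] EuclideanSpace ℝ (Fin m)) : ℝ :=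
  A.toLinearMap.singularValues 0

/-- The right singular space `{v | A* A v = σ² v}` of `A` for `σ`. -/
def rightSingularSpace (A : EuclideanSpace ℝ (Fin d) →L[ℝ] EuclideanSpace ℝ (Fin m)) (σ : ℝ) :
    Submodule ℝ (EuclideanSpace ℝ (Fin d)) :=
  (gram A).eigenspace (σ ^ 2)

/-- `σ ≥ 0` is a singular value of `A`: `σ²` is an eigenvalue of `A* A`. -/
def IsSingularValue (A : EuclideanSpace ℝ (Fin d) →L[ℝ] EuclideanSpace ℝ (Fin m)) (σ : ℝ) : Prop :=
  0 ≤ σ ∧ (gram A).HasEigenvalue (σ ^ 2)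

/-- `v` is a right singular vector of `A` for the singular value `σ ≥ 0`: `v ≠ 0` and
`A* A v = σ² v`. -/
def IsRightSingularVector (A : EuclideanSpace ℝ (Fin d) →L[ℝ] EuclideanSpace ℝ (Fin m)) (σ : ℝ)
    (v : EuclideanSpace ℝ (Fin d)) : Prop :=
  0 ≤ σ ∧ (gram A).HasEigenvector (σ ^ 2) v

/-- The search direction `x = (y - ⟨y, v⟩ v) / ‖y - ⟨y, v⟩ v‖` (`x = 0` if `y` is a multiple of the
unit vector `v`). -/
def direction (v y : EuclideanSpace ℝ (Fin d)) : EuclideanSpace ℝ (Fin d) :=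
  ‖y - ⟪y, v⟫ • v‖⁻¹ • (y - ⟪y, v⟫ • v)

/-- The number `a = ⟨A v, A x⟩`. -/
def coeffA (A : EuclideanSpace ℝ (Fin d) →L[ℝ] EuclideanSpace ℝ (Fin m))
    (v x : EuclideanSpace ℝ (Fin d)) : ℝ :=
  ⟪A v, A x⟫

/-- The number `b = ‖A x‖² - ‖A v‖²`. -/
def coeffB (A : EuclideanSpace ℝ (Fin d) →L[ℝ] EuclideanSpace ℝ (Fin m))
    (v x : EuclideanSpace ℝ (Fin d)) : ℝ :=
  ‖A x‖ ^ 2 - ‖A v‖ ^ 2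

/-- The stepsize `τ = sign(a) (b / (2 |a|) + √(b² / (4 a²) + 1))` of the exact line search.
If `a = 0`, where the formula breaks down, no step is made (`τ = 0`). -/
def stepsize (a b : ℝ) : ℝ :=
  if a = 0 then 0
  else Real.sign a * (b / (2 * |a|) + Real.sqrt (b ^ 2 / (4 * a ^ 2) + 1))

/-- One step `v ↦ (v + τ x) / √(1 + τ²)` of the algorithm, with the sample `y`. -/
def update (A : EuclideanSpace ℝ (Fin d) →L[ℝ] EuclideanSpace ℝ (Fin m))
    (v y : EuclideanSpace ℝ (Fin d)) : EuclideanSpace ℝ (Fin d) :=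
  let x := direction v y
  let τ := stepsize (coeffA A v x) (coeffB A v x)
  (Real.sqrt (1 + τ ^ 2))⁻¹ • (v + τ • x)

/-- The iterates `v^k` of the algorithm, started at `v0` and driven by the samples `y 0, y 1, …`. -/
def iterate (A : EuclideanSpace ℝ (Fin d) →L[ℝ] EuclideanSpace ℝ (Fin m))
    (v0 : EuclideanSpace ℝ (Fin d)) (y : ℕ → EuclideanSpace ℝ (Fin d)) :
    ℕ → EuclideanSpace ℝ (Fin d)
  | 0 => v0
  | k + 1 => update A (iterate A v0 y k) (y k)

/-- The numbers `a_k = ⟨A v^k, A x^k⟩` along the iteration. -/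
def iterateA (A : EuclideanSpace ℝ (Fin d) →L[ℝ] EuclideanSpace ℝ (Fin m))
    (v0 : EuclideanSpace ℝ (Fin d)) (y : ℕ → EuclideanSpace ℝ (Fin d)) (k : ℕ) : ℝ :=
  coeffA A (iterate A v0 y k) (direction (iterate A v0 y k) (y k))

end RandomSearchNorm

end

/-!
The almost sure convergence of the iteration rests on two properties of the exact line search.

* The value `‖A v^{k+1}‖` is the maximum of `‖A z‖ / ‖z‖` over the plane spanned by `v^k` and `y^k`,
  provided that `a_k ≠ 0` (`norm_map_add_smul_sq_le`). Hence `‖A v^k‖` is nondecreasing, and it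
  dominates the Rayleigh quotient `‖A y^k‖ / ‖y^k‖` of the sample (`norm_map_sample_le`). The samples
  are independent with a common law that charges every nonempty open set, so almost surely their
  Rayleigh quotients have supremum `‖A‖` (`ae_forall_exists_lt_norm_map`), and `‖A v^k‖ → ‖A‖`
  (`tendsto_norm_map_iterate`). No rate or drift estimate is needed.
* The angle between consecutive iterates is acute (`inner_update_pos`). If the top singular space is
  the line spanned by a unit vector `u`, the iterates approach `{u, -u}` by compactness, and an
  acute angle does not allow them to switch sides (`exists_tendsto_of_inner_pos`).

It remains to exclude `a_k = 0` away from the top singular space. With the residual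
`r(v) = A* A v - ‖A v‖² v`, which vanishes at a unit vector exactly if this is a right singular
vector, `a_k = 0` means `⟪r(v^k), y^k⟫ = 0`, an event of probability zero if `r(v^k) ≠ 0`, as `y^k` is
independent of `v^k`. If `r(v^k) ≠ 0`, the next iterate lies in an eigenspace `F` of `A* A` only if
`y^k ∈ span v^k + F`, which has probability zero unless `span v^k + F` is the whole space
(`ae_span_sup_eigenspace_eq_top`). In that case `F` has codimension at most one; this contradicts the
assumption on multiplicities in the last claim. In general, since `‖A v^k‖² ≤ ‖A v^{k+1}‖²`, where the
latter is the eigenvalue of `F`, that eigenvalue is the largest one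
(`norm_sq_le_of_span_sup_eigenspace_eq_top`). So the iteration never enters a lower singular space.
-/

namespace RandomSearchNorm

variable {d m : ℕ} {A : EuclideanSpace ℝ (Fin d) →L[ℝ] EuclideanSpace ℝ (Fin m)}
  {v x y : EuclideanSpace ℝ (Fin d)}

/-! ### Singular vectors and the residual -/

lemma inner_gram (A : EuclideanSpace ℝ (Fin d) →L[ℝ] EuclideanSpace ℝ (Fin m))
    (v w : EuclideanSpace ℝ (Fin d)) : ⟪gram A v, w⟫ = ⟪A v, A w⟫ := by
  simp [gram, ContinuousLinearMap.adjoint_inner_left]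

lemma continuous_gram (A : EuclideanSpace ℝ (Fin d) →L[ℝ] EuclideanSpace ℝ (Fin m)) :
    Continuous (gram A) :=
  (ContinuousLinearMap.adjoint A ∘L A).continuous

lemma norm_gram_le (A : EuclideanSpace ℝ (Fin d) →L[ℝ] EuclideanSpace ℝ (Fin m))
    (v : EuclideanSpace ℝ (Fin d)) : ‖gram A v‖ ≤ ‖A‖ * ‖A v‖ := by
  have h := (ContinuousLinearMap.adjoint A).le_opNorm (A v)
  rwa [LinearIsometryEquiv.norm_map] at h

lemma sigmaOne_nonneg (A : EuclideanSpace ℝ (Fin d) →L[ℝ] EuclideanSpace ℝ (Fin m)) :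
    0 ≤ sigmaOne A :=
  A.toLinearMap.singularValues_nonneg 0

/-- The largest singular value is the operator norm: expand `‖A v‖² = ⟪A* A v, v⟫` in an
orthonormal basis of eigenvectors of `A* A`. -/
theorem sigmaOne_eq_norm (A : EuclideanSpace ℝ (Fin d) →L[ℝ] EuclideanSpace ℝ (Fin m)) :
    sigmaOne A = ‖A‖ := by
  have hn : Module.finrank ℝ (EuclideanSpace ℝ (Fin d)) = d := by simp
  have hT := A.toLinearMap.isSymmetric_adjoint_comp_self
  have hgram (v w : EuclideanSpace ℝ (Fin d)) :
      ⟪(A.toLinearMap.adjoint ∘ₗ A.toLinearMap) v, w⟫ = ⟪A v, A w⟫ := by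
    simp [LinearMap.adjoint_inner_left]
  apply le_antisymm
  · rcases Nat.eq_zero_or_pos d with rfl | hd
    · rw [sigmaOne, LinearMap.singularValues_of_finrank_le _ (by simp)]
      exact norm_nonneg _
    · set e := hT.eigenvectorBasis hn ⟨0, hd⟩ with he
      have hne : ‖e‖ = 1 := (hT.eigenvectorBasis hn).orthonormal.1 _
      have hAe : ‖A e‖ ^ 2 = sigmaOne A ^ 2 := by
        rw [← real_inner_self_eq_norm_sq, ← hgram, he, hT.apply_eigenvectorBasis, ← he,
          sigmaOne, LinearMap.sq_singularValues_of_lt _ hn hd, inner_smul_left,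
          real_inner_self_eq_norm_sq, hne]
        simp
      have := A.le_opNorm e
      rw [hne, mul_one] at this
      rwa [← (pow_left_inj₀ (norm_nonneg _) (sigmaOne_nonneg A) two_ne_zero).1 hAe]
  · refine A.opNorm_le_bound (sigmaOne_nonneg A) fun v => ?_
    refine le_of_sq_le_sq ?_ (mul_nonneg (sigmaOne_nonneg A) (norm_nonneg v))
    set b := hT.eigenvectorBasis hn
    rw [mul_pow, ← b.sum_sq_inner_right v, Finset.mul_sum, ← real_inner_self_eq_norm_sq,
      ← hgram, ← b.sum_inner_mul_inner]
    refine Finset.sum_le_sum fun i _ => ?_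
    have h1 : ⟪(A.toLinearMap.adjoint ∘ₗ A.toLinearMap) v, b i⟫
        = A.toLinearMap.singularValues i ^ 2 * ⟪b i, v⟫ := by
      rw [hT, hT.apply_eigenvectorBasis, inner_smul_right, real_inner_comm,
        LinearMap.sq_singularValues_fin _ hn]
      rfl
    rw [h1, mul_assoc, ← sq]
    refine mul_le_mul_of_nonneg_right ?_ (sq_nonneg _)
    exact pow_le_pow_left₀ (LinearMap.singularValues_nonneg _ _)
      (A.toLinearMap.singularValues_antitone (Nat.zero_le _)) 2

/-- The residual `A* A v - ‖A v‖² v`. It vanishes at a unit vector `v` exactly if `v` is a right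
singular vector; it is the tangential part of the gradient of `v ↦ ‖A v‖² / 2` on the sphere. -/
noncomputable def residual (A : EuclideanSpace ℝ (Fin d) →L[ℝ] EuclideanSpace ℝ (Fin m))
    (v : EuclideanSpace ℝ (Fin d)) : EuclideanSpace ℝ (Fin d) :=
  gram A v - ‖A v‖ ^ 2 • v

lemma continuous_residual (A : EuclideanSpace ℝ (Fin d) →L[ℝ] EuclideanSpace ℝ (Fin m)) :
    Continuous (residual A) := by
  have := continuous_gram A
  unfold residual
  fun_prop

lemma inner_residual (A : EuclideanSpace ℝ (Fin d) →L[ℝ] EuclideanSpace ℝ (Fin m))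
    (v w : EuclideanSpace ℝ (Fin d)) :
    ⟪residual A v, w⟫ = ⟪A v, A w⟫ - ‖A v‖ ^ 2 * ⟪v, w⟫ := by
  rw [residual, inner_sub_left, inner_gram, real_inner_smul_left]

lemma inner_residual_self (hv : ‖v‖ = 1) : ⟪residual A v, v⟫ = 0 := by
  rw [inner_residual, real_inner_self_eq_norm_sq, real_inner_self_eq_norm_sq, hv]
  ring

lemma eq_norm_sq_of_gram_eq_smul {c : ℝ} (hv : ‖v‖ = 1) (h : gram A v = c • v) :
    c = ‖A v‖ ^ 2 := by
  rw [← real_inner_self_eq_norm_sq, ← inner_gram, h, real_inner_smul_left,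
    real_inner_self_eq_norm_sq, hv]
  ring

lemma isRightSingularVector_iff {σ : ℝ} (hv : ‖v‖ = 1) :
    IsRightSingularVector A σ v ↔ σ = ‖A v‖ ∧ residual A v = 0 := by
  have hv0 : v ≠ 0 := norm_ne_zero_iff.1 (by simp [hv])
  rw [IsRightSingularVector, Module.End.hasEigenvector_iff, Module.End.mem_eigenspace_iff,
    residual, sub_eq_zero]
  constructor
  · rintro ⟨h0, h, -⟩
    have := eq_norm_sq_of_gram_eq_smul hv h
    rw [← this]
    exact ⟨(pow_left_inj₀ h0 (norm_nonneg _) two_ne_zero).1 this, h⟩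
  · rintro ⟨rfl, h⟩
    exact ⟨norm_nonneg _, h, hv0⟩

/-- A unit vector that maximizes `‖A v‖` is a right singular vector. -/
lemma residual_eq_zero_of_norm_eq (hv : ‖v‖ = 1) (h : ‖A v‖ = ‖A‖) : residual A v = 0 := by
  rw [← norm_eq_zero, ← sq_eq_zero_iff]
  refine le_antisymm ?_ (sq_nonneg _)
  have h1 : ‖residual A v‖ ^ 2 = ‖gram A v‖ ^ 2 - ‖A v‖ ^ 4 := by
    rw [residual, norm_sub_sq_real, real_inner_smul_right, inner_gram,
      real_inner_self_eq_norm_sq, norm_smul, hv, Real.norm_of_nonneg (sq_nonneg _)]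
    ring
  have h2 := pow_le_pow_left₀ (norm_nonneg _) (norm_gram_le A v) 2
  rw [h1, h] at *
  nlinarith

/-! ### The exact line search -/

lemma norm_direction (h : direction v y ≠ 0) : ‖direction v y‖ = 1 := by
  have h0 : ‖y - ⟪y, v⟫ • v‖ ≠ 0 := by
    intro h0
    exact h (by simp [direction, h0])
  rw [direction, norm_smul, norm_inv, norm_norm, inv_mul_cancel₀ h0]

lemma inner_direction (hv : ‖v‖ = 1) : ⟪v, direction v y⟫ = 0 := by
  rw [direction, real_inner_smul_right, inner_sub_right, real_inner_smul_right,
    real_inner_self_eq_norm_sq, hv, real_inner_comm]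
  ring

lemma eq_smul_add_smul_direction (v y : EuclideanSpace ℝ (Fin d)) :
    y = ⟪y, v⟫ • v + ‖y - ⟪y, v⟫ • v‖ • direction v y := by
  by_cases h0 : ‖y - ⟪y, v⟫ • v‖ = 0
  · rw [h0, zero_smul, add_zero]
    exact sub_eq_zero.1 (norm_eq_zero.1 h0)
  · rw [direction, smul_smul, mul_inv_cancel₀ h0, one_smul, add_sub_cancel]

/-- The line search breaks down exactly if the sample is orthogonal to the residual. -/
lemma coeffA_direction_eq_zero_iff (hv : ‖v‖ = 1) :
    coeffA A v (direction v y) = 0 ↔ ⟪residual A v, y⟫ = 0 := by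
  have h1 : coeffA A v (direction v y) = ⟪residual A v, direction v y⟫ := by
    rw [inner_residual, inner_direction hv, coeffA]
    ring
  have h2 : ⟪residual A v, y⟫
      = ‖y - ⟪y, v⟫ • v‖ * ⟪residual A v, direction v y⟫ := by
    conv_lhs => rw [eq_smul_add_smul_direction v y]
    rw [inner_add_right, real_inner_smul_right, real_inner_smul_right, inner_residual_self hv]
    ring
  rw [h1, h2, mul_eq_zero]
  refine ⟨Or.inr, ?_⟩
  rintro (h | h)
  · simp [direction, h]
  · exact h

lemma stepsize_zero_left (b : ℝ) : stepsize 0 b = 0 := by simp [stepsize]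

lemma mul_stepsize_pos {a : ℝ} (ha : a ≠ 0) (b : ℝ) : 0 < a * stepsize a b := by
  have h1 : |b| / (2 * |a|) < √(b ^ 2 / (4 * a ^ 2) + 1) := by
    apply Real.lt_sqrt_of_sq_lt
    rw [div_pow, mul_pow, sq_abs, sq_abs]
    norm_num
  have h2 : -(|b| / (2 * |a|)) ≤ b / (2 * |a|) := by
    rw [← neg_div]
    gcongr
    exact neg_abs_le b
  rw [stepsize, if_neg ha, ← mul_assoc]
  refine mul_pos ?_ (by linarith)
  rcases lt_or_gt_of_ne ha with h | h
  · rw [Real.sign_of_neg h]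
    linarith
  · rw [Real.sign_of_pos h]
    linarith

/-- The stepsize is a critical point of the Rayleigh quotient along the line. -/
lemma mul_stepsize_sq {a : ℝ} (ha : a ≠ 0) (b : ℝ) :
    a * stepsize a b ^ 2 = b * stepsize a b + a := by
  rw [stepsize, if_neg ha]
  set r := √(b ^ 2 / (4 * a ^ 2) + 1) with hr
  have hr2 : r ^ 2 = b ^ 2 / (4 * a ^ 2) + 1 := Real.sq_sqrt (by positivity)
  rcases lt_or_gt_of_ne ha with h | h
  · rw [Real.sign_of_neg h, abs_of_neg h]
    have : (-1 * (b / (2 * -a) + r)) ^ 2 = b ^ 2 / (4 * a ^ 2) - b / a * r + r ^ 2 := by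
      field_simp
      ring
    rw [this, hr2]
    field_simp
    ring
  · rw [Real.sign_of_pos h, abs_of_pos h]
    have : (1 * (b / (2 * a) + r)) ^ 2 = b ^ 2 / (4 * a ^ 2) + b / a * r + r ^ 2 := by
      field_simp
      ring
    rw [this, hr2]
    field_simp
    ring

lemma norm_add_smul_sq (hv : ‖v‖ = 1) (hx : ‖x‖ = 1) (hvx : ⟪v, x⟫ = 0) (s t : ℝ) :
    ‖s • v + t • x‖ ^ 2 = s ^ 2 + t ^ 2 := by
  rw [norm_add_sq_real, real_inner_smul_left, real_inner_smul_right, hvx, norm_smul, norm_smul,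
    hv, hx]
  simp

lemma norm_map_add_smul_sq (s t : ℝ) :
    ‖A (s • v + t • x)‖ ^ 2
      = s ^ 2 * ‖A v‖ ^ 2 + 2 * (s * t) * coeffA A v x + t ^ 2 * ‖A x‖ ^ 2 := by
  rw [map_add, map_smul, map_smul, norm_add_sq_real, real_inner_smul_left, real_inner_smul_right,
    norm_smul, norm_smul, mul_pow, mul_pow, Real.norm_eq_abs, Real.norm_eq_abs, sq_abs, sq_abs,
    coeffA]
  ring

lemma coeffA_zero_right : coeffA A v 0 = 0 := by simp [coeffA]

lemma direction_ne_zero_of_coeffA_ne_zero (ha : coeffA A v (direction v y) ≠ 0) :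
    direction v y ≠ 0 := by
  intro h
  rw [h] at ha
  exact ha coeffA_zero_right

lemma update_of_coeffA_eq_zero (ha : coeffA A v (direction v y) = 0) : update A v y = v := by
  simp [update, ha, stepsize_zero_left]

lemma norm_update (hv : ‖v‖ = 1) : ‖update A v y‖ = 1 := by
  by_cases ha : coeffA A v (direction v y) = 0
  · rw [update_of_coeffA_eq_zero ha, hv]
  · have hx := norm_direction (direction_ne_zero_of_coeffA_ne_zero ha)
    simp only [update]
    set τ := stepsize (coeffA A v (direction v y)) (coeffB A v (direction v y))
    have h := norm_add_smul_sq hv hx (inner_direction hv) 1 τ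
    rw [one_smul, one_pow] at h
    rw [norm_smul, norm_inv, Real.norm_of_nonneg (Real.sqrt_nonneg _), ← h,
      Real.sqrt_sq (norm_nonneg _), inv_mul_cancel₀]
    intro h0
    rw [h0] at h
    nlinarith [sq_nonneg τ]

/-- Consecutive iterates make an acute angle. -/
lemma inner_update_pos (hv : ‖v‖ = 1) : 0 < ⟪v, update A v y⟫ := by
  simp only [update]
  rw [real_inner_smul_right, inner_add_right, real_inner_smul_right, inner_direction hv,
    real_inner_self_eq_norm_sq, hv]
  have : 0 < √(1 + stepsize (coeffA A v (direction v y)) (coeffB A v (direction v y)) ^ 2) :=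
    Real.sqrt_pos.2 (by positivity)
  simpa using this

/-- The value of the line search is the top eigenvalue `‖A v‖² + a τ` of the quadratic form
`z ↦ ‖A z‖²` on the plane spanned by `v` and the search direction. -/
lemma norm_map_update_sq (ha : coeffA A v (direction v y) ≠ 0) :
    ‖A (update A v y)‖ ^ 2 = ‖A v‖ ^ 2 + coeffA A v (direction v y) *
      stepsize (coeffA A v (direction v y)) (coeffB A v (direction v y)) := by
  have hτ := mul_stepsize_sq ha (coeffB A v (direction v y))
  simp only [update]
  set a := coeffA A v (direction v y) with ha_def
  set τ := stepsize a (coeffB A v (direction v y))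
  have h := norm_map_add_smul_sq (A := A) (v := v) (x := direction v y) 1 τ
  rw [one_smul, ← ha_def] at h
  rw [coeffB] at hτ
  rw [map_smul, norm_smul, mul_pow, h, norm_inv, Real.norm_of_nonneg (Real.sqrt_nonneg _),
    inv_pow, Real.sq_sqrt (by positivity)]
  have : (0 : ℝ) < 1 + τ ^ 2 := by positivity
  field_simp
  linear_combination τ * (-hτ)

/-- The line search is exact: its value dominates `‖A z‖ / ‖z‖` on the plane spanned by `v` and
the search direction. -/
lemma norm_map_add_smul_sq_le (ha : coeffA A v (direction v y) ≠ 0) (s t : ℝ) :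
    ‖A (s • v + t • direction v y)‖ ^ 2 ≤ ‖A (update A v y)‖ ^ 2 * (s ^ 2 + t ^ 2) := by
  rw [norm_map_update_sq ha, norm_map_add_smul_sq]
  have hpos := mul_stepsize_pos ha (coeffB A v (direction v y))
  have hτ := mul_stepsize_sq ha (coeffB A v (direction v y))
  set a := coeffA A v (direction v y)
  set τ := stepsize a (coeffB A v (direction v y))
  rw [coeffB] at hτ
  have hτ0 : τ ≠ 0 := right_ne_zero_of_mul hpos.ne'
  -- the difference of both sides is a multiple of the square `(τ s - t)²`
  have key : (‖A v‖ ^ 2 + a * τ) * (s ^ 2 + t ^ 2)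
      - (s ^ 2 * ‖A v‖ ^ 2 + 2 * (s * t) * a + t ^ 2 * ‖A (direction v y)‖ ^ 2)
      = a * τ / τ ^ 2 * (τ * s - t) ^ 2 := by
    field_simp
    linear_combination t ^ 2 * hτ
  have : 0 ≤ a * τ / τ ^ 2 * (τ * s - t) ^ 2 := by positivity
  linarith

/-- After a step that does not break down, `‖A v‖` is at least the value at the sample. -/
lemma norm_map_sample_le (hv : ‖v‖ = 1) (ha : coeffA A v (direction v y) ≠ 0) :
    ‖A y‖ ≤ ‖A (update A v y)‖ * ‖y‖ := by
  refine le_of_sq_le_sq ?_ (by positivity)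
  have hx := norm_direction (direction_ne_zero_of_coeffA_ne_zero ha)
  have h := norm_map_add_smul_sq_le ha ⟪y, v⟫ ‖y - ⟪y, v⟫ • v‖
  rwa [← norm_add_smul_sq hv hx (inner_direction hv), ← eq_smul_add_smul_direction,
    ← mul_pow] at h

lemma norm_map_lt_norm_map_update (ha : coeffA A v (direction v y) ≠ 0) :
    ‖A v‖ < ‖A (update A v y)‖ := by
  refine lt_of_pow_lt_pow_left₀ 2 (norm_nonneg _) ?_
  rw [norm_map_update_sq ha]
  linarith [mul_stepsize_pos ha (coeffB A v (direction v y))]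

lemma norm_map_le_norm_map_update : ‖A v‖ ≤ ‖A (update A v y)‖ := by
  by_cases ha : coeffA A v (direction v y) = 0
  · rw [update_of_coeffA_eq_zero ha]
  · exact (norm_map_lt_norm_map_update ha).le

/-- If the step does not break down and leads into a subspace `F`, then the sample lies in the
span of `v` and `F`. -/
lemma sample_mem_of_update_mem {F : Submodule ℝ (EuclideanSpace ℝ (Fin d))}
    (ha : coeffA A v (direction v y) ≠ 0) (hF : update A v y ∈ F) : y ∈ ℝ ∙ v ⊔ F := by
  have hpos := mul_stepsize_pos ha (coeffB A v (direction v y))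
  simp only [update] at hF
  set τ := stepsize (coeffA A v (direction v y)) (coeffB A v (direction v y))
  have hτ0 : τ ≠ 0 := right_ne_zero_of_mul hpos.ne'
  have hs : (√(1 + τ ^ 2))⁻¹ ≠ 0 := (inv_pos.2 (Real.sqrt_pos.2 (by positivity))).ne'
  have h1 : v + τ • direction v y ∈ ℝ ∙ v ⊔ F :=
    Submodule.mem_sup_right ((F.smul_mem_iff hs).1 hF)
  have hv : v ∈ ℝ ∙ v ⊔ F := Submodule.mem_sup_left (Submodule.mem_span_singleton_self v)
  have h2 : direction v y ∈ ℝ ∙ v ⊔ F := by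
    rw [← Submodule.smul_mem_iff _ hτ0]
    simpa using Submodule.sub_mem _ h1 hv
  rw [eq_smul_add_smul_direction v y]
  exact Submodule.add_mem _ (Submodule.smul_mem _ _ hv) (Submodule.smul_mem _ _ h2)

/-- If `v` and the eigenspace of `A* A` for `c` span the whole space and `‖A v‖² < c ‖v‖²`, then
`c` is the top eigenvalue: the orthogonal complement of the eigenspace is at most a line, on
which `‖A z‖² ≤ c ‖z‖²`. -/
lemma norm_sq_le_of_span_sup_eigenspace_eq_top {c : ℝ} (hc : 0 ≤ c)
    (hvc : ‖A v‖ ^ 2 ≤ c * ‖v‖ ^ 2)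
    (htop : ℝ ∙ v ⊔ (gram A).eigenspace c = ⊤) : ‖A‖ ^ 2 ≤ c := by
  set F := (gram A).eigenspace c
  have hsplit {g h : EuclideanSpace ℝ (Fin d)} (hg : g ∈ F) (hh : h ∈ Fᗮ) (r : ℝ) :
      ‖A (g + r • h)‖ ^ 2 = c * ‖g‖ ^ 2 + r ^ 2 * ‖A h‖ ^ 2 ∧
        ‖g + r • h‖ ^ 2 = ‖g‖ ^ 2 + r ^ 2 * ‖h‖ ^ 2 := by
    have hgh : ⟪g, h⟫ = 0 := hh g hg
    have hgg : gram A g = c • g := Module.End.mem_eigenspace_iff.1 hg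
    have h1 : ⟪A g, A h⟫ = 0 := by
      rw [← inner_gram, hgg, real_inner_smul_left, hgh, mul_zero]
    have h2 : ‖A g‖ ^ 2 = c * ‖g‖ ^ 2 := by
      rw [← real_inner_self_eq_norm_sq, ← inner_gram, hgg, real_inner_smul_left,
        real_inner_self_eq_norm_sq]
    constructor
    · rw [map_add, map_smul, norm_add_sq_real, real_inner_smul_right, h1, h2, norm_smul, mul_pow,
        Real.norm_eq_abs, sq_abs]
      ring
    · rw [norm_add_sq_real, real_inner_smul_right, hgh, norm_smul, mul_pow, Real.norm_eq_abs,
        sq_abs]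
      ring
  obtain ⟨f, hf, h, hh, rfl⟩ := F.exists_add_mem_mem_orthogonal v
  have hAh : ‖A h‖ ^ 2 ≤ c * ‖h‖ ^ 2 := by
    obtain ⟨h1, h2⟩ := hsplit hf hh 1
    rw [one_smul] at h1 h2
    rw [h1, h2] at hvc
    linarith
  rw [← Real.le_sqrt (norm_nonneg _) hc]
  refine A.opNorm_le_bound (Real.sqrt_nonneg c) fun z => ?_
  have hz : z ∈ ℝ ∙ (f + h) ⊔ F := htop ▸ Submodule.mem_top
  obtain ⟨p, hp, g, hg, rfl⟩ := Submodule.mem_sup.1 hz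
  obtain ⟨r, rfl⟩ := Submodule.mem_span_singleton.1 hp
  refine le_of_sq_le_sq ?_ (by positivity)
  rw [mul_pow, Real.sq_sqrt hc,
    show r • (f + h) + g = (g + r • f) + r • h by rw [smul_add]; abel]
  obtain ⟨h1, h2⟩ := hsplit (F.add_mem hg (F.smul_mem r hf)) hh r
  rw [h1, h2]
  nlinarith [mul_le_mul_of_nonneg_left hAh (sq_nonneg r)]

end RandomSearchNorm

/-! ### The standard Gaussian measure -/

namespace ProbabilityTheory

section stdGaussian

variable {E : Type*} [NormedAddCommGroup E] [InnerProductSpace ℝ E] [FiniteDimensional ℝ E]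
  [MeasurableSpace E] [BorelSpace E]

lemma ae_stdGaussian_inner_ne_zero {w : E} (hw : w ≠ 0) :
    ∀ᵐ y ∂stdGaussian E, ⟪w, y⟫ ≠ 0 := by
  have hmap := IsGaussian.map_eq_gaussianReal (μ := stdGaussian E) (innerSL ℝ w)
  have hvar : (Var[innerSL ℝ w; stdGaussian E]).toNNReal ≠ 0 := by
    rw [variance_dual_stdGaussian, innerSL_apply_norm]
    simpa using hw
  have := nullSingletonClass_gaussianReal (μ := (stdGaussian E)[innerSL ℝ w]) hvar
  have h0 : ∀ᵐ t ∂(stdGaussian E).map (innerSL ℝ w), t ≠ 0 := by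
    rw [hmap]
    refine ae_iff.2 (Eq.trans (congrArg _ ?_) (measure_singleton (0 : ℝ)))
    ext t
    simp
  exact ae_of_ae_map (f := innerSL ℝ w) (by fun_prop) h0

lemma ae_stdGaussian_notMem {F : Submodule ℝ E} (hF : F ≠ ⊤) :
    ∀ᵐ y ∂stdGaussian E, y ∉ F := by
  obtain ⟨w, hw, hw0⟩ := Submodule.exists_mem_ne_zero_of_ne_bot
    (mt Submodule.orthogonal_eq_bot_iff.1 hF)
  filter_upwards [ae_stdGaussian_inner_ne_zero hw0] with y hy hyF
  exact hy (by rw [real_inner_comm]; exact hw y hyF)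

instance isOpenPosMeasure_stdGaussian : (stdGaussian E).IsOpenPosMeasure := by
  have : (gaussianReal 0 1).IsOpenPosMeasure :=
    (gaussianReal_absolutelyContinuous' 0 one_ne_zero).isOpenPosMeasure
  rw [stdGaussian]
  refine Continuous.isOpenPosMeasure_map (by fun_prop) fun z => ?_
  exact ⟨fun i => ⟪stdOrthonormalBasis ℝ E i, z⟫, (stdOrthonormalBasis ℝ E).sum_repr' z⟩

end stdGaussian

end ProbabilityTheory

/-! ### Independence -/

section independence

variable {Ω : Type*} [MeasurableSpace Ω] {P : Measure Ω} [IsProbabilityMeasure P]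

/-- If `X` is independent of `(Y, Z)` and `Y` is independent of `Z`, then `(X, Y)` is independent
of `Z`. -/
lemma ProbabilityTheory.IndepFun.prodMk_of_prodMk {α β γ : Type*} [MeasurableSpace α]
    [MeasurableSpace β] [MeasurableSpace γ] {X : Ω → α} {Y : Ω → β} {Z : Ω → γ}
    (hX : AEMeasurable X P) (hY : AEMeasurable Y P) (hZ : AEMeasurable Z P)
    (h : IndepFun X (fun ω => (Y ω, Z ω)) P) (hYZ : IndepFun Y Z P) :
    IndepFun (fun ω => (X ω, Y ω)) Z P := by
  have := Measure.isProbabilityMeasure_map hX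
  have := Measure.isProbabilityMeasure_map hY
  have := Measure.isProbabilityMeasure_map hZ
  have hXY : IndepFun X Y P := h.comp measurable_id measurable_fst
  rw [indepFun_iff_map_prod_eq_prod_map_map (by fun_prop) (by fun_prop)] at *
  rw [hYZ] at h
  rw [hXY, ← (measurePreserving_prodAssoc (P.map X) (P.map Y) (P.map Z)).symm.map_eq, ← h,
    AEMeasurable.map_map_of_aemeasurable (by fun_prop) (by fun_prop)]
  rfl

/-- Fubini for independent variables: a property of `(X, Y)` that holds for every value of `X`
and almost every value of `Y` holds almost surely. -/
lemma ProbabilityTheory.IndepFun.ae_of_forall_ae {α β : Type*} [MeasurableSpace α]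
    [MeasurableSpace β] {X : Ω → α} {Y : Ω → β} {ν : Measure β} (hX : AEMeasurable X P)
    (hY : HasLaw Y ν P) (h : IndepFun X Y P) {p : α → β → Prop}
    (hp : MeasurableSet {z : α × β | p z.1 z.2}) (hae : ∀ x, ∀ᵐ y ∂ν, p x y) :
    ∀ᵐ ω ∂P, p (X ω) (Y ω) := by
  have := Measure.isProbabilityMeasure_map hX
  have := Measure.isProbabilityMeasure_map hY.aemeasurable
  rw [indepFun_iff_map_prod_eq_prod_map_map hX hY.aemeasurable] at h
  have h1 : ∀ᵐ z ∂(P.map fun ω => (X ω, Y ω)), p z.1 z.2 := by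
    rw [h, Measure.ae_prod_iff_ae_ae hp, hY.map_eq]
    exact ae_of_all _ hae
  exact ae_of_ae_map (hX.prodMk hY.aemeasurable) h1

/-- An independent sequence with a common law visits every set of positive measure almost
surely. -/
lemma ProbabilityTheory.iIndepFun.ae_exists_mem {β : Type*} [MeasurableSpace β] {y : ℕ → Ω → β}
    {ν : Measure β} (hy : ∀ k, HasLaw (y k) ν P) (hind : iIndepFun y P) {U : Set β}
    (hU : MeasurableSet U) (hpos : ν U ≠ 0) : ∀ᵐ ω ∂P, ∃ k, y k ω ∈ U := by
  have hprob : IsProbabilityMeasure ν :=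
    (hy 0).map_eq ▸ Measure.isProbabilityMeasure_map (hy 0).aemeasurable
  have hlt : ν Uᶜ < 1 := by
    rw [prob_compl_eq_one_sub hU]
    exact ENNReal.sub_lt_self ENNReal.one_ne_top one_ne_zero hpos
  have hle (n : ℕ) : P {ω | ¬ ∃ k, y k ω ∈ U} ≤ ν Uᶜ ^ n := by
    have h := hind.measure_inter_preimage_eq_mul (Finset.range n) (sets := fun _ => Uᶜ)
      fun _ _ => hU.compl
    have h2 (k : ℕ) : P (y k ⁻¹' Uᶜ) = ν Uᶜ := by
      rw [← (hy k).map_eq, Measure.map_apply_of_aemeasurable (hy k).aemeasurable hU.compl]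
    simp only [h2, Finset.prod_const, Finset.card_range] at h
    rw [← h]
    refine measure_mono fun ω hω => ?_
    simp only [Set.mem_iInter]
    exact fun k _ hk => hω ⟨k, hk⟩
  rw [ae_iff, ← nonpos_iff_eq_zero]
  exact ge_of_tendsto' (ENNReal.tendsto_pow_atTop_nhds_zero_of_lt_one hlt) hle

end independence

namespace RandomSearchNorm

variable {d m : ℕ} {A : EuclideanSpace ℝ (Fin d) →L[ℝ] EuclideanSpace ℝ (Fin m)}

/-! ### Measurability of the iteration -/

@[fun_prop]
lemma measurable_direction :
    Measurable fun z : EuclideanSpace ℝ (Fin d) × EuclideanSpace ℝ (Fin d) =>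
      direction z.1 z.2 := by
  unfold direction
  fun_prop

@[fun_prop]
lemma measurable_coeffA (A : EuclideanSpace ℝ (Fin d) →L[ℝ] EuclideanSpace ℝ (Fin m)) :
    Measurable fun z : EuclideanSpace ℝ (Fin d) × EuclideanSpace ℝ (Fin d) =>
      coeffA A z.1 (direction z.1 z.2) := by
  unfold coeffA
  fun_prop

@[fun_prop]
lemma measurable_coeffB (A : EuclideanSpace ℝ (Fin d) →L[ℝ] EuclideanSpace ℝ (Fin m)) :
    Measurable fun z : EuclideanSpace ℝ (Fin d) × EuclideanSpace ℝ (Fin d) =>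
      coeffB A z.1 (direction z.1 z.2) := by
  unfold coeffB
  fun_prop

lemma measurable_stepsize : Measurable fun z : ℝ × ℝ => stepsize z.1 z.2 := by
  have hsign : Measurable Real.sign :=
    Measurable.ite measurableSet_Iio measurable_const
      (Measurable.ite measurableSet_Ioi measurable_const measurable_const)
  unfold stepsize
  refine Measurable.ite (measurable_fst (measurableSet_singleton 0)) measurable_const ?_
  fun_prop

@[fun_prop]
lemma measurable_update (A : EuclideanSpace ℝ (Fin d) →L[ℝ] EuclideanSpace ℝ (Fin m)) :
    Measurable fun z : EuclideanSpace ℝ (Fin d) × EuclideanSpace ℝ (Fin d) =>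
      update A z.1 z.2 := by
  have h := measurable_stepsize.comp ((measurable_coeffA A).prodMk (measurable_coeffB A))
  simp only [Function.comp_def] at h
  simp only [update]
  fun_prop

lemma measurable_iterate (A : EuclideanSpace ℝ (Fin d) →L[ℝ] EuclideanSpace ℝ (Fin m)) (k : ℕ) :
    Measurable fun z : EuclideanSpace ℝ (Fin d) × (ℕ → EuclideanSpace ℝ (Fin d)) =>
      iterate A z.1 z.2 k := by
  induction k with
  | zero => exact measurable_fst
  | succ k ih =>
    have hk : Measurable fun z : EuclideanSpace ℝ (Fin d) × (ℕ → EuclideanSpace ℝ (Fin d)) =>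
        z.2 k := (measurable_pi_apply k).comp measurable_snd
    have h : Measurable fun z : EuclideanSpace ℝ (Fin d) × (ℕ → EuclideanSpace ℝ (Fin d)) =>
        (iterate A z.1 z.2 k, z.2 k) := ih.prodMk hk
    have hcomp := (measurable_update A).comp h
    simp only [Function.comp_def] at hcomp
    simpa only [iterate] using hcomp

lemma iterate_congr {v : EuclideanSpace ℝ (Fin d)} {y z : ℕ → EuclideanSpace ℝ (Fin d)} {k : ℕ}
    (h : ∀ j < k, y j = z j) : iterate A v y k = iterate A v z k := by
  induction k with
  | zero => rfl
  | succ k ih =>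
    rw [iterate, iterate, ih fun j hj => h j (hj.trans k.lt_succ_self), h k k.lt_succ_self]

section random

variable {Ω : Type*} [MeasurableSpace Ω] {P : Measure Ω}
  {v0 : Ω → EuclideanSpace ℝ (Fin d)} {y : ℕ → Ω → EuclideanSpace ℝ (Fin d)}

lemma aemeasurable_iterate (hv0 : AEMeasurable v0 P) (hy : ∀ k, AEMeasurable (y k) P) (k : ℕ) :
    AEMeasurable (fun ω => iterate A (v0 ω) (fun j => y j ω) k) P :=
  (measurable_iterate A k).comp_aemeasurable (hv0.prodMk (aemeasurable_pi_lambda _ hy))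

/-- The iterate `v^k` depends on the start and the first `k` samples only, hence is independent
of the sample `y k`. -/
lemma indepFun_iterate [IsProbabilityMeasure P] (hv0 : AEMeasurable v0 P)
    (hy : ∀ k, AEMeasurable (y k) P) (hind : iIndepFun y P) (hv0_ind : IndepFun v0 (fun ω k => y k ω) P) (k : ℕ) :
    IndepFun (fun ω => iterate A (v0 ω) (fun j => y j ω) k) (y k) P := by
  have h1 : IndepFun (fun ω (i : Finset.range k) => y i ω) (y k) P :=
    (hind.indepFun_finset₀ (Finset.range k) {k} (by simp) hy).comp measurable_id
      (measurable_pi_apply (⟨k, Finset.mem_singleton_self k⟩ : ({k} : Finset ℕ)))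
  have h2 : IndepFun v0 (fun ω => ((fun i : Finset.range k => y i ω), y k ω)) P :=
    hv0_ind.comp (φ := id)
      (ψ := fun z : ℕ → EuclideanSpace ℝ (Fin d) => ((fun i : Finset.range k => z i), z k))
      measurable_id (by fun_prop)
  have h3 := h2.prodMk_of_prodMk hv0 (aemeasurable_pi_lambda _ fun i : Finset.range k => hy i) (hy k) h1
  -- pad the first `k` samples by zeros to a full sequence
  let pad : (Finset.range k → EuclideanSpace ℝ (Fin d)) → ℕ → EuclideanSpace ℝ (Fin d) :=
    fun z j => if hj : j ∈ Finset.range k then z ⟨j, hj⟩ else 0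
  have hpad : Measurable pad := by
    refine measurable_pi_lambda _ fun j => ?_
    by_cases hj : j ∈ Finset.range k
    · simp only [pad, dif_pos hj]
      fun_prop
    · simp only [pad, dif_neg hj]
      fun_prop
  have hpad' : Measurable fun z : EuclideanSpace ℝ (Fin d) ×
      (Finset.range k → EuclideanSpace ℝ (Fin d)) => iterate A z.1 (pad z.2) k :=
    (measurable_iterate A k).comp (measurable_fst.prodMk (hpad.comp measurable_snd))
  have h4 := h3.comp hpad' measurable_id
  convert! h4 using 1
  funext ω
  exact iterate_congr fun j hj => by simp [pad, hj]

/-- A measurable property of one step that holds for almost every sample, whatever the current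
point is, almost surely holds at all steps of the iteration. -/
lemma ae_forall_iterate [IsProbabilityMeasure P] (hv0 : AEMeasurable v0 P)
    (hy : ∀ k, HasLaw (y k) (stdGaussian (EuclideanSpace ℝ (Fin d))) P)
    (hind : iIndepFun y P) (hv0_ind : IndepFun v0 (fun ω k => y k ω) P)
    {p : EuclideanSpace ℝ (Fin d) → EuclideanSpace ℝ (Fin d) → Prop}
    (hp : MeasurableSet {z : EuclideanSpace ℝ (Fin d) × EuclideanSpace ℝ (Fin d) | p z.1 z.2})
    (hae : ∀ v, ∀ᵐ y ∂stdGaussian (EuclideanSpace ℝ (Fin d)), p v y) :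
    ∀ᵐ ω ∂P, ∀ k, p (iterate A (v0 ω) (fun j => y j ω) k) (y k ω) := by
  have hm := fun k => (hy k).aemeasurable
  rw [ae_all_iff]
  exact fun k => (indepFun_iterate hv0 hm hind hv0_ind k).ae_of_forall_ae
    (aemeasurable_iterate hv0 hm k) (hy k) hp hae

/-- The form of `ae_forall_iterate` for steps from points that are no right singular vectors. -/
lemma ae_forall_iterate_of_residual_ne_zero [IsProbabilityMeasure P] (hv0 : AEMeasurable v0 P)
    (hy : ∀ k, HasLaw (y k) (stdGaussian (EuclideanSpace ℝ (Fin d))) P)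
    (hind : iIndepFun y P) (hv0_ind : IndepFun v0 (fun ω k => y k ω) P)
    {q : EuclideanSpace ℝ (Fin d) → EuclideanSpace ℝ (Fin d) → Prop}
    (hq : MeasurableSet {z : EuclideanSpace ℝ (Fin d) × EuclideanSpace ℝ (Fin d) | q z.1 z.2})
    (hae : ∀ v, ‖v‖ = 1 → residual A v ≠ 0 →
      ∀ᵐ y ∂stdGaussian (EuclideanSpace ℝ (Fin d)), q v y) :
    ∀ᵐ ω ∂P, ∀ k, ‖iterate A (v0 ω) (fun j => y j ω) k‖ = 1 →
      residual A (iterate A (v0 ω) (fun j => y j ω) k) ≠ 0 →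
        q (iterate A (v0 ω) (fun j => y j ω) k) (y k ω) := by
  have hS : MeasurableSet {v : EuclideanSpace ℝ (Fin d) | ‖v‖ = 1 ∧ residual A v ≠ 0} :=
    (measurableSet_eq_fun measurable_norm measurable_const).inter
      ((continuous_residual A).measurable (measurableSet_singleton 0).compl)
  refine (ae_forall_iterate (A := A)
    (p := fun v z => (‖v‖ = 1 ∧ residual A v ≠ 0) → q v z) hv0 hy hind hv0_ind ?_
    fun v => ?_).mono fun ω h k h1 h2 => h k ⟨h1, h2⟩
  · simp only [imp_iff_not_or, Set.ofPred_or]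
    exact (measurable_fst hS).compl.union hq
  · by_cases hv : ‖v‖ = 1 ∧ residual A v ≠ 0
    · filter_upwards [hae v hv.1 hv.2] with z hz _ using hz
    · exact ae_of_all _ fun _ h => absurd h hv

/-- Almost surely, the Rayleigh quotients of the samples come arbitrarily close to the operator
norm. -/
lemma ae_forall_exists_lt_norm_map [IsProbabilityMeasure P]
    (hy : ∀ k, HasLaw (y k) (stdGaussian (EuclideanSpace ℝ (Fin d))) P) (hind : iIndepFun y P) :
    ∀ᵐ ω ∂P, ∀ r, 0 ≤ r → r < ‖A‖ → ∃ k, r * ‖y k ω‖ < ‖A (y k ω)‖ := by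
  have h (q : ℚ) : ∀ᵐ ω ∂P, 0 ≤ (q : ℝ) → (q : ℝ) < ‖A‖ →
      ∃ k, q * ‖y k ω‖ < ‖A (y k ω)‖ := by
    by_cases hq : 0 ≤ (q : ℝ) ∧ (q : ℝ) < ‖A‖
    · have hopen : IsOpen {z : EuclideanSpace ℝ (Fin d) | q * ‖z‖ < ‖A z‖} :=
        isOpen_lt (by fun_prop) (by fun_prop)
      have hne : {z : EuclideanSpace ℝ (Fin d) | q * ‖z‖ < ‖A z‖}.Nonempty := by
        by_contra! hemp
        refine hq.2.not_ge (A.opNorm_le_bound hq.1 fun z => not_lt.1 fun hz => ?_)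
        exact Set.notMem_empty z (hemp ▸ hz)
      filter_upwards [hind.ae_exists_mem hy hopen.measurableSet (hopen.measure_pos _ hne).ne']
        with ω hω _ _
      exact hω
    · exact ae_of_all _ fun ω h0 h1 => absurd ⟨h0, h1⟩ hq
  filter_upwards [ae_all_iff.2 h] with ω hω r hr0 hr
  obtain ⟨q, hrq, hq⟩ := exists_rat_btwn hr
  obtain ⟨k, hk⟩ := hω q (hr0.trans hrq.le) hq
  exact ⟨k, lt_of_le_of_lt (by gcongr) hk⟩

end random

/-! ### One step of the iteration -/

lemma ae_coeffA_ne_zero {v : EuclideanSpace ℝ (Fin d)} (hv : ‖v‖ = 1) (hr : residual A v ≠ 0) :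
    ∀ᵐ y ∂stdGaussian (EuclideanSpace ℝ (Fin d)), coeffA A v (direction v y) ≠ 0 := by
  filter_upwards [ae_stdGaussian_inner_ne_zero hr] with y hy h
  exact hy ((coeffA_direction_eq_zero_iff hv).1 h)

/-- From a point that is no right singular vector, a step almost surely leads into an eigenspace
of `A* A` only if that eigenspace and the current point span the whole space. -/
lemma ae_span_sup_eigenspace_eq_top {v : EuclideanSpace ℝ (Fin d)} (hv : ‖v‖ = 1)
    (hr : residual A v ≠ 0) :
    ∀ᵐ y ∂stdGaussian (EuclideanSpace ℝ (Fin d)), ∀ c : ℝ,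
      update A v y ∈ (gram A).eigenspace c → ℝ ∙ v ⊔ (gram A).eigenspace c = ⊤ := by
  have hfin : {c | (gram A).HasEigenvalue c}.Finite := Module.End.finite_hasEigenvalue _
  have h1 : ∀ᵐ y ∂stdGaussian (EuclideanSpace ℝ (Fin d)), ∀ c ∈ {c | (gram A).HasEigenvalue c},
      y ∈ ℝ ∙ v ⊔ (gram A).eigenspace c → ℝ ∙ v ⊔ (gram A).eigenspace c = ⊤ := by
    rw [ae_ball_iff hfin.countable]
    intro c _
    by_cases htop : ℝ ∙ v ⊔ (gram A).eigenspace c = ⊤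
    · exact ae_of_all _ fun _ _ => htop
    · filter_upwards [ae_stdGaussian_notMem htop] with y hy hy'
      exact absurd hy' hy
  filter_upwards [h1, ae_coeffA_ne_zero hv hr] with y hy ha c hc
  refine hy c ?_ (sample_mem_of_update_mem ha hc)
  refine Module.End.hasEigenvalue_of_hasEigenvector (x := update A v y) ⟨hc, ?_⟩
  exact norm_ne_zero_iff.1 (by simp [norm_update hv])

lemma mem_eigenspace_of_residual_eq_zero {v : EuclideanSpace ℝ (Fin d)} (h : residual A v = 0) :
    v ∈ (gram A).eigenspace (‖A v‖ ^ 2) :=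
  Module.End.mem_eigenspace_iff.2 (sub_eq_zero.1 h)

/-- From a point that is no right singular vector, a step almost surely leads to a right singular
vector only if that one maximizes `‖A v‖`. An eigenspace of codimension one is avoided because
the step strictly increases `‖A v‖`. -/
lemma ae_norm_map_update_eq {v : EuclideanSpace ℝ (Fin d)} (hv : ‖v‖ = 1)
    (hr : residual A v ≠ 0) :
    ∀ᵐ y ∂stdGaussian (EuclideanSpace ℝ (Fin d)),
      residual A (update A v y) = 0 → ‖A (update A v y)‖ = ‖A‖ := by
  filter_upwards [ae_span_sup_eigenspace_eq_top hv hr] with y hy h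
  have htop := hy _ (mem_eigenspace_of_residual_eq_zero h)
  have hle := A.le_opNorm (update A v y)
  rw [norm_update hv, mul_one] at hle
  refine le_antisymm hle (le_of_sq_le_sq ?_ (norm_nonneg _))
  refine norm_sq_le_of_span_sup_eigenspace_eq_top (sq_nonneg _) ?_ htop
  rw [hv, one_pow, mul_one]
  exact pow_le_pow_left₀ (norm_nonneg _) norm_map_le_norm_map_update 2

/-- If no eigenspace of `A* A` has codimension at most one, a step from a point that is no right
singular vector almost surely does not lead to one. -/
lemma ae_residual_update_ne_zero {v : EuclideanSpace ℝ (Fin d)} (hv : ‖v‖ = 1)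
    (hr : residual A v ≠ 0)
    (hmult : ∀ σ, IsSingularValue A σ → Module.finrank ℝ (rightSingularSpace A σ) + 1 ≠ d ∧
      Module.finrank ℝ (rightSingularSpace A σ) ≠ d) :
    ∀ᵐ y ∂stdGaussian (EuclideanSpace ℝ (Fin d)), residual A (update A v y) ≠ 0 := by
  filter_upwards [ae_span_sup_eigenspace_eq_top hv hr] with y hy h
  have hmem := mem_eigenspace_of_residual_eq_zero h
  have htop := hy _ hmem
  have hne : update A v y ≠ 0 := norm_ne_zero_iff.1 (by simp [norm_update hv])
  have hσ : IsSingularValue A ‖A (update A v y)‖ :=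
    ⟨norm_nonneg _, Module.End.hasEigenvalue_of_hasEigenvector ⟨hmem, hne⟩⟩
  obtain ⟨h1, h2⟩ := hmult _ hσ
  rw [rightSingularSpace] at h1 h2
  have h3 := Submodule.finrank_add_le_finrank_add_finrank (ℝ ∙ v)
    ((gram A).eigenspace (‖A (update A v y)‖ ^ 2))
  rw [htop, finrank_top, finrank_euclideanSpace_fin] at h3
  have h4 := finrank_span_singleton (K := ℝ) (norm_ne_zero_iff.1 (by simp [hv]) : v ≠ 0)
  have h5 := Submodule.finrank_le ((gram A).eigenspace (‖A (update A v y)‖ ^ 2))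
  rw [finrank_euclideanSpace_fin] at h5
  omega

end RandomSearchNorm

namespace RandomSearchNorm

variable {d m : ℕ} {A : EuclideanSpace ℝ (Fin d) →L[ℝ] EuclideanSpace ℝ (Fin m)}

/-! ### Deterministic consequences along the iteration -/

lemma mem_rightSingularSpace_of_norm_map_eq {v : EuclideanSpace ℝ (Fin d)} (hv : ‖v‖ = 1)
    (h : ‖A v‖ = ‖A‖) : v ∈ rightSingularSpace A (sigmaOne A) := by
  rw [rightSingularSpace, sigmaOne_eq_norm, ← h]
  exact mem_eigenspace_of_residual_eq_zero (residual_eq_zero_of_norm_eq hv h)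

/-- A sequence of unit vectors that maximizes `‖A v‖` in the limit approaches the unit vectors
`±u` of a one-dimensional top singular space; if consecutive terms make acute angles, it cannot
switch between neighbourhoods of `u` and `-u`, so it converges. -/
lemma exists_tendsto_of_inner_pos {v : ℕ → EuclideanSpace ℝ (Fin d)} (hv : ∀ k, ‖v k‖ = 1)
    (hacute : ∀ k, 0 < ⟪v k, v (k + 1)⟫)
    (hlim : Tendsto (fun k => ‖A (v k)‖) atTop (𝓝 ‖A‖))
    (hdim : Module.finrank ℝ (rightSingularSpace A (sigmaOne A)) = 1) :
    ∃ u, IsRightSingularVector A (sigmaOne A) u ∧ Tendsto v atTop (𝓝 u) := by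
  obtain ⟨⟨w, hw⟩, hw0, hspan⟩ := finrank_eq_one_iff'.1 hdim
  have hw0' : w ≠ 0 := fun h => hw0 (Subtype.ext h)
  set u := ‖w‖⁻¹ • w with hu_def
  have hu1 : ‖u‖ = 1 := norm_smul_inv_norm (𝕜 := ℝ) hw0'
  have hu : u ∈ rightSingularSpace A (sigmaOne A) := Submodule.smul_mem _ _ hw
  have hmax {z : EuclideanSpace ℝ (Fin d)} (hz : ‖z‖ = 1) (hAz : ‖A z‖ = ‖A‖) :
      z = u ∨ z = -u := by
    obtain ⟨c, hc⟩ := hspan ⟨z, mem_rightSingularSpace_of_norm_map_eq hz hAz⟩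
    have hzw : c • w = z := congrArg Subtype.val hc
    have hzu : z = (c * ‖w‖) • u := by
      rw [hu_def, smul_smul, mul_assoc, mul_inv_cancel₀ (norm_ne_zero_iff.2 hw0'), mul_one, hzw]
    have habs : |c * ‖w‖| = 1 := by
      rw [hzu, norm_smul, hu1, mul_one] at hz
      exact hz
    rcases eq_or_eq_neg_of_abs_eq habs with h | h
    · exact Or.inl (by rw [hzu, h, one_smul])
    · exact Or.inr (by rw [hzu, h, neg_one_smul])
  have hnear (ε : ℝ) (hε : 0 < ε) : ∀ᶠ k in atTop, dist (v k) u < ε ∨ dist (v k) (-u) < ε := by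
    -- on the part of the sphere away from `±u`, a compact set, `‖A z‖` stays away from `‖A‖`
    have hK : IsCompact (Metric.sphere (0 : EuclideanSpace ℝ (Fin d)) 1 \
        (Metric.ball u ε ∪ Metric.ball (-u) ε)) :=
      (isCompact_sphere _ _).diff (Metric.isOpen_ball.union Metric.isOpen_ball)
    have hclosed := (hK.image (f := fun z => ‖A z‖) (by fun_prop)).isClosed
    have hnot : ‖A‖ ∉ (fun z => ‖A z‖) '' (Metric.sphere (0 : EuclideanSpace ℝ (Fin d)) 1 \
        (Metric.ball u ε ∪ Metric.ball (-u) ε)) := by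
      rintro ⟨z, ⟨hz, hzn⟩, hAz⟩
      rw [mem_sphere_zero_iff_norm] at hz
      rcases hmax hz hAz with rfl | rfl
      · exact hzn (Or.inl (Metric.mem_ball_self hε))
      · exact hzn (Or.inr (Metric.mem_ball_self hε))
    filter_upwards [hlim.eventually (hclosed.isOpen_compl.mem_nhds hnot)] with k hk
    by_contra h
    exact hk ⟨v k, ⟨mem_sphere_zero_iff_norm.2 (hv k), h⟩, rfl⟩
  have hdist {s : EuclideanSpace ℝ (Fin d)} (hs : ‖s‖ = 1) : dist s (-s) = 2 := by
    rw [dist_eq_norm, sub_neg_eq_add, ← two_smul ℝ s, norm_smul, hs]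
    norm_num
  -- a jump between the balls of radius `1 / 4` has length at least `3 / 2 > √2`
  have hstay {s : EuclideanSpace ℝ (Fin d)} (hs : ‖s‖ = 1) (k : ℕ) (h1 : dist (v k) s < 1 / 4)
      (h2 : dist (v (k + 1)) (-s) < 1 / 4) : False := by
    have h3 : ‖v (k + 1) - v k‖ ^ 2 < 2 := by
      rw [norm_sub_sq_real, hv, hv, real_inner_comm]
      linarith [hacute k]
    have h4 := hdist hs
    have h5 : dist s (-s) ≤ dist (v k) s + dist (v (k + 1)) (v k) + dist (v (k + 1)) (-s) := by
      rw [dist_comm (v k) s, dist_comm (v (k + 1)) (v k)]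
      exact dist_triangle4 _ _ _ _
    rw [dist_eq_norm (v (k + 1)) (v k)] at h5
    nlinarith
  have hconv {s : EuclideanSpace ℝ (Fin d)} (hs : ‖s‖ = 1)
      (hns : ∀ ε > 0, ∀ᶠ k in atTop, dist (v k) s < ε ∨ dist (v k) (-s) < ε) {N : ℕ}
      (hN : ∀ k ≥ N, dist (v k) s < 1 / 4 ∨ dist (v k) (-s) < 1 / 4)
      (hNs : dist (v N) s < 1 / 4) : Tendsto v atTop (𝓝 s) := by
    have hall : ∀ k ≥ N, dist (v k) s < 1 / 4 := by
      intro k hk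
      induction k, hk using Nat.le_induction with
      | base => exact hNs
      | succ k hk ih =>
        exact (hN (k + 1) (hk.trans k.le_succ)).resolve_right fun h => hstay hs k ih h
    rw [Metric.tendsto_nhds]
    intro ε hε
    filter_upwards [hns (min ε (1 / 4)) (by positivity), eventually_ge_atTop N] with k hk hkN
    rcases hk with hk | hk
    · exact hk.trans_le (min_le_left _ _)
    · have h4 := hdist hs
      have h5 := dist_triangle_left s (-s) (v k)
      have h6 := hall k hkN
      have h7 := hk.trans_le (min_le_right _ _)
      linarith
  have hsing {s : EuclideanSpace ℝ (Fin d)} (hs : ‖s‖ = 1)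
      (hsm : s ∈ rightSingularSpace A (sigmaOne A)) : IsRightSingularVector A (sigmaOne A) s :=
    ⟨sigmaOne_nonneg A, hsm, norm_ne_zero_iff.1 (by simp [hs])⟩
  obtain ⟨N, hN⟩ := eventually_atTop.1 (hnear (1 / 4) (by norm_num))
  rcases hN N le_rfl with h | h
  · exact ⟨u, hsing hu1 hu, hconv hu1 hnear hN h⟩
  · have hu1' : ‖-u‖ = 1 := by rw [norm_neg, hu1]
    refine ⟨-u, hsing hu1' (Submodule.neg_mem _ hu), hconv hu1' ?_ ?_ h⟩
    · simpa only [neg_neg, or_comm] using hnear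
    · simpa only [neg_neg, or_comm] using hN

variable {v0 : EuclideanSpace ℝ (Fin d)} {y : ℕ → EuclideanSpace ℝ (Fin d)}

lemma norm_iterate (hv0 : ‖v0‖ = 1) (k : ℕ) : ‖iterate A v0 y k‖ = 1 := by
  induction k with
  | zero => exact hv0
  | succ k ih => exact norm_update ih

/-- If the start is no lower singular vector and no step leads from a point that is no right
singular vector to a lower one, then no iterate is a lower singular vector. -/
lemma norm_map_iterate_eq_of_residual_eq_zero (hv0 : ‖v0‖ = 1)
    (hstart : residual A v0 = 0 → ‖A v0‖ = ‖A‖)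
    (hstep : ∀ k, residual A (iterate A v0 y k) ≠ 0 →
      residual A (update A (iterate A v0 y k) (y k)) = 0 →
        ‖A (update A (iterate A v0 y k) (y k))‖ = ‖A‖) (k : ℕ) :
    residual A (iterate A v0 y k) = 0 → ‖A (iterate A v0 y k)‖ = ‖A‖ := by
  induction k with
  | zero => exact hstart
  | succ k ih =>
    by_cases hr : residual A (iterate A v0 y k) = 0
    · have ha : coeffA A (iterate A v0 y k) (direction (iterate A v0 y k) (y k)) = 0 :=
        (coeffA_direction_eq_zero_iff (norm_iterate hv0 k)).2 (by rw [hr, inner_zero_left])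
      intro _
      rw [iterate, update_of_coeffA_eq_zero ha]
      exact ih hr
    · exact hstep k hr

/-- The values `‖A v^k‖` increase and, by exactness of the line search, dominate the Rayleigh
quotients of the samples; so they converge to the supremum `‖A‖` of the latter. -/
lemma tendsto_norm_map_iterate (hv0 : ‖v0‖ = 1)
    (hbreak : ∀ k, coeffA A (iterate A v0 y k) (direction (iterate A v0 y k) (y k)) = 0 →
      ‖A (iterate A v0 y k)‖ = ‖A‖)
    (hsup : ∀ r, 0 ≤ r → r < ‖A‖ → ∃ k, r * ‖y k‖ < ‖A (y k)‖) :
    Tendsto (fun k => ‖A (iterate A v0 y k)‖) atTop (𝓝 ‖A‖) := by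
  have hmono : Monotone fun k => ‖A (iterate A v0 y k)‖ :=
    monotone_nat_of_le_succ fun k => norm_map_le_norm_map_update
  have hle (k : ℕ) : ‖A (iterate A v0 y k)‖ ≤ ‖A‖ := by
    simpa [norm_iterate hv0 k] using A.le_opNorm (iterate A v0 y k)
  refine tendsto_atTop_isLUB hmono ⟨Set.forall_mem_range.2 hle, fun b hb => ?_⟩
  have hb' (k : ℕ) : ‖A (iterate A v0 y k)‖ ≤ b := hb (Set.mem_range_self k)
  by_contra! hlt
  obtain ⟨k, hk⟩ := hsup b ((norm_nonneg _).trans (hb' 0)) hlt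
  by_cases ha : coeffA A (iterate A v0 y k) (direction (iterate A v0 y k) (y k)) = 0
  · exact absurd (hbreak k ha) ((hb' k).trans_lt hlt).ne
  · have h1 := norm_map_sample_le (norm_iterate hv0 k) ha
    have h2 : ‖A (update A (iterate A v0 y k) (y k))‖ ≤ b := hb' (k + 1)
    exact absurd (hk.trans_le h1) (not_lt.2 (by gcongr))

end RandomSearchNorm

/-! ### Convergence of the iteration -/

theorem mainTheorem1 {d m : ℕ}
    (A : EuclideanSpace ℝ (Fin d) →L[ℝ] EuclideanSpace ℝ (Fin m))
    {Ω : Type*} [MeasurableSpace Ω] (P : Measure Ω) [IsProbabilityMeasure P]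
    -- the random starting point, independent of the samples
    (v0 : Ω → EuclideanSpace ℝ (Fin d)) (hv0_meas : AEMeasurable v0 P)
    (hv0_norm : ∀ᵐ ω ∂P, ‖v0 ω‖ = 1)
    (hv0_sing : ∀ᵐ ω ∂P, ∀ σ < RandomSearchNorm.sigmaOne A,
      ¬ RandomSearchNorm.IsRightSingularVector A σ (v0 ω))
    -- the samples, independent and standard normal
    (y : ℕ → Ω → EuclideanSpace ℝ (Fin d))
    (hy_law : ∀ k, HasLaw (y k) (stdGaussian (EuclideanSpace ℝ (Fin d))) P)
    (hy_indep : iIndepFun y P)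
    (hv0_indep : IndepFun v0 (fun ω k => y k ω) P) :
    RandomSearchNorm.sigmaOne A = ‖A‖ ∧
    -- `‖A v^k‖` converges to `σ₁` almost surely
    (∀ᵐ ω ∂P, Tendsto (fun k => ‖A (RandomSearchNorm.iterate A (v0 ω) (fun j => y j ω) k)‖)
      atTop (𝓝 (RandomSearchNorm.sigmaOne A))) ∧
    -- convergence to a right singular vector if the top singular space is a line
    (Module.finrank ℝ
        (RandomSearchNorm.rightSingularSpace A (RandomSearchNorm.sigmaOne A)) = 1 →
      ∀ᵐ ω ∂P, ∃ u : EuclideanSpace ℝ (Fin d),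
        RandomSearchNorm.IsRightSingularVector A (RandomSearchNorm.sigmaOne A) u ∧
        Tendsto (fun k => RandomSearchNorm.iterate A (v0 ω) (fun j => y j ω) k) atTop (𝓝 u)) ∧
    -- almost surely, the stepsize formula breaks down at right singular vectors for `σ₁` only
    (∀ᵐ ω ∂P, ∀ k, RandomSearchNorm.iterateA A (v0 ω) (fun j => y j ω) k = 0 →
      RandomSearchNorm.IsRightSingularVector A (RandomSearchNorm.sigmaOne A)
        (RandomSearchNorm.iterate A (v0 ω) (fun j => y j ω) k)) ∧
    -- and never, if no singular value has multiplicity `d - 1` or `d` and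
    -- the start is not a right singular vector
    ((∀ σ, RandomSearchNorm.IsSingularValue A σ →
        Module.finrank ℝ (RandomSearchNorm.rightSingularSpace A σ) + 1 ≠ d ∧
        Module.finrank ℝ (RandomSearchNorm.rightSingularSpace A σ) ≠ d) →
      (∀ᵐ ω ∂P, ∀ σ, ¬ RandomSearchNorm.IsRightSingularVector A σ (v0 ω)) →
      ∀ᵐ ω ∂P, ∀ k, RandomSearchNorm.iterateA A (v0 ω) (fun j => y j ω) k ≠ 0) := by
  have hA_eq := RandomSearchNorm.sigmaOne_eq_norm A
  have hres : MeasurableSet {v | RandomSearchNorm.residual A v = 0} :=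
    (RandomSearchNorm.continuous_residual A).measurable (measurableSet_singleton 0)
  have hnorm : MeasurableSet {v | ‖A v‖ = ‖A‖} :=
    measurableSet_eq_fun (by fun_prop) measurable_const
  -- from an iterate that is no right singular vector, the step does not break down
  have hbreak := RandomSearchNorm.ae_forall_iterate_of_residual_ne_zero (A := A) hv0_meas hy_law
    hy_indep hv0_indep
    (q := fun v z => RandomSearchNorm.coeffA A v (RandomSearchNorm.direction v z) ≠ 0)
    (RandomSearchNorm.measurable_coeffA A (measurableSet_singleton 0).compl)
    fun v hv hr => RandomSearchNorm.ae_coeffA_ne_zero hv hr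
  -- and it does not lead to a right singular vector for a smaller singular value
  have hlower := RandomSearchNorm.ae_forall_iterate_of_residual_ne_zero (A := A) hv0_meas hy_law
    hy_indep hv0_indep
    (q := fun v z => RandomSearchNorm.residual A (RandomSearchNorm.update A v z) = 0 →
      ‖A (RandomSearchNorm.update A v z)‖ = ‖A‖)
    (by
      simp only [imp_iff_not_or, Set.ofPred_or]
      exact (RandomSearchNorm.measurable_update A hres).compl.union
        (RandomSearchNorm.measurable_update A hnorm))
    fun v hv hr => RandomSearchNorm.ae_norm_map_update_eq hv hr
  have hstart : ∀ᵐ ω ∂P, RandomSearchNorm.residual A (v0 ω) = 0 → ‖A (v0 ω)‖ = ‖A‖ := by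
    filter_upwards [hv0_norm, hv0_sing] with ω h1 hsing hr
    have hle := A.le_opNorm (v0 ω)
    rw [h1, mul_one] at hle
    by_contra hne
    exact hsing ‖A (v0 ω)‖ (by rw [hA_eq]; exact lt_of_le_of_ne hle hne)
      ((RandomSearchNorm.isRightSingularVector_iff h1).2 ⟨rfl, hr⟩)
  have htop : ∀ᵐ ω ∂P, ∀ k,
      RandomSearchNorm.iterateA A (v0 ω) (fun j => y j ω) k = 0 →
        RandomSearchNorm.residual A
            (RandomSearchNorm.iterate A (v0 ω) (fun j => y j ω) k) = 0 ∧
          ‖A (RandomSearchNorm.iterate A (v0 ω) (fun j => y j ω) k)‖ = ‖A‖ := by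
    filter_upwards [hv0_norm, hstart, hbreak, hlower] with ω h1 h2 h3 h4 k hk
    have hr : RandomSearchNorm.residual A
        (RandomSearchNorm.iterate A (v0 ω) (fun j => y j ω) k) = 0 := by
      by_contra hr
      exact h3 k (RandomSearchNorm.norm_iterate h1 k) hr hk
    exact ⟨hr, RandomSearchNorm.norm_map_iterate_eq_of_residual_eq_zero h1 h2
      (fun j => h4 j (RandomSearchNorm.norm_iterate h1 j)) k hr⟩
  have hlim : ∀ᵐ ω ∂P, Tendsto
      (fun k => ‖A (RandomSearchNorm.iterate A (v0 ω) (fun j => y j ω) k)‖) atTop (𝓝 ‖A‖) := by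
    filter_upwards [hv0_norm, htop,
      RandomSearchNorm.ae_forall_exists_lt_norm_map (A := A) hy_law hy_indep] with ω h1 h2 h3
    exact RandomSearchNorm.tendsto_norm_map_iterate h1 (fun k hk => (h2 k hk).2) h3
  refine ⟨hA_eq, by rwa [hA_eq], fun hdim => ?_, ?_, fun hmult hv0_ne => ?_⟩
  · filter_upwards [hv0_norm, hlim] with ω h1 h2
    exact RandomSearchNorm.exists_tendsto_of_inner_pos (RandomSearchNorm.norm_iterate h1)
      (fun k => RandomSearchNorm.inner_update_pos (RandomSearchNorm.norm_iterate h1 k)) h2 hdim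
  · filter_upwards [hv0_norm, htop] with ω h1 h2 k hk
    obtain ⟨hr, hA⟩ := h2 k hk
    exact (RandomSearchNorm.isRightSingularVector_iff (RandomSearchNorm.norm_iterate h1 k)).2
      ⟨by rw [hA_eq, hA], hr⟩
  · have hne := RandomSearchNorm.ae_forall_iterate_of_residual_ne_zero (A := A) hv0_meas hy_law
      hy_indep hv0_indep
      (q := fun v z => RandomSearchNorm.residual A (RandomSearchNorm.update A v z) ≠ 0)
      (RandomSearchNorm.measurable_update A hres).compl
      fun v hv hr => RandomSearchNorm.ae_residual_update_ne_zero hv hr hmult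
    filter_upwards [hv0_norm, hv0_ne, hbreak, hne] with ω h1 h2 h3 h4 k
    have hr : RandomSearchNorm.residual A
        (RandomSearchNorm.iterate A (v0 ω) (fun j => y j ω) k) ≠ 0 := by
      induction k with
      | zero =>
        exact fun hr => h2 _ ((RandomSearchNorm.isRightSingularVector_iff h1).2 ⟨rfl, hr⟩)
      | succ k ih => exact h4 k (RandomSearchNorm.norm_iterate h1 k) ih
    exact h3 k (RandomSearchNorm.norm_iterate h1 k) hr
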